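/- For a domain $D\subset\mathbb C^n$, $z\in D$ and $X\in\mathbb C^n$, the Sibony metric is $$S_D(z;X):=\sup_v\Big[\sum_{j,k=1}^n\frac{\partial^2 v}{\partial z_j\,\partial\bar z_k}(z)\,X_j\overline{X_k}\Big]^{1/2},$$ where the supremum is taken over all functions $v:D\to[0,1)$ such that $v(z)=0$, $\log v$ is plurisubharmonic on $D$ (with $\log 0=-\infty$; the constant $-\infty$ is counted as plurisubharmonic), and $v$ is of class $\mathcal C^2$ near $z$. Let $V^S_D(z)$ be the Lebesgue measure of the indicatrix $\{X\in\mathbb C^n: S_D(z;X)<1\}$. **Proposition 3.** Let $D$ be a bounded domain in $\mathbb C^n$ whose boundary is of class $\mathcal C^1$ near $p\in\partial D$, i.e. there are an open neighbourhood $U$ of $p$ and a $\mathcal C^1$ function $\rho:U\to\mathbb R$ with nowhere vanishing differential such that $D\cap U=\{z\in U:\rho(z)<0\}$. Then $$\lim_{D\ni z\to p}V^S_D(z)=0.$$ -/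

import Mathlib

open MeasureTheory Set Filter Topology
open scoped ENNReal

noncomputable section

/-- The mean value of an extended-real function `g` over `(0, 2π]`: the mean of the positive part
minus the mean of the negative part. For `g` bounded above (as for an upper semicontinuous
function with values in `[-∞, ∞)` on a circle) it is the usual mean value in `[-∞, ∞)`. -/
def angularMean (g : ℝ → EReal) : EReal :=
  ((laverage (volume.restrict (Ioc 0 (2 * Real.pi))) fun t => (g t).toENNReal : ℝ≥0∞) : EReal) -
    ((laverage (volume.restrict (Ioc 0 (2 * Real.pi))) fun t => (-(g t)).toENNReal : ℝ≥0∞) : EReal)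

/-- `u : D → [-∞, ∞)` is plurisubharmonic on the open set `D ⊆ ℂⁿ`: it is upper semicontinuous, and
its restriction to every complex line is subharmonic, that is, it satisfies the sub-mean value
inequality on all sufficiently small circles about each point. Only the values on `D` matter. -/
structure IsPlurisubharmonicOn {n : ℕ} (u : EuclideanSpace ℂ (Fin n) → EReal)
    (D : Set (EuclideanSpace ℂ (Fin n))) : Prop where
  lt_top : ∀ z ∈ D, u z < ⊤
  usc : UpperSemicontinuousOn u D
  submean : ∀ a ∈ D, ∀ b : EuclideanSpace ℂ (Fin n), ∃ R : ℝ, 0 < R ∧ ∀ r : ℝ, 0 < r → r < R →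
    u a ≤ angularMean fun t => u (a + (circleMap 0 r t) • b)

/-- The Wirtinger derivative `∂g/∂z_j = (∂g/∂x_j - i ∂g/∂y_j) / 2`. -/
def dz {n : ℕ} (j : Fin n) (g : EuclideanSpace ℂ (Fin n) → ℂ) (z : EuclideanSpace ℂ (Fin n)) : ℂ :=
  (fderiv ℝ g z (EuclideanSpace.single j 1)
    - Complex.I * fderiv ℝ g z (EuclideanSpace.single j Complex.I)) / 2

/-- The Wirtinger derivative `∂g/∂z̄_k = (∂g/∂x_k + i ∂g/∂y_k) / 2`. -/
def dzbar {n : ℕ} (k : Fin n) (g : EuclideanSpace ℂ (Fin n) → ℂ)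
    (z : EuclideanSpace ℂ (Fin n)) : ℂ :=
  (fderiv ℝ g z (EuclideanSpace.single k 1)
    + Complex.I * fderiv ℝ g z (EuclideanSpace.single k Complex.I)) / 2

/-- The Levi form `∑ⱼ ∑ₖ ∂²v/∂z_j∂z̄_k (z) X_j X̄_k`, a real number when `v` is real and `C²`. -/
def leviForm {n : ℕ} (v : EuclideanSpace ℂ (Fin n) → ℝ) (z X : EuclideanSpace ℂ (Fin n)) : ℝ :=
  (∑ j, ∑ k, dz j (dzbar k fun w => (v w : ℂ)) z * X j * (starRingEnd ℂ) (X k)).re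

/-- The competitors in the definition of the Sibony metric of `D` at `z`: functions
`v : D → [0, 1)` with `v z = 0`, `log v` plurisubharmonic on `D` (with `log 0 = -∞`), and `v` of
class `C²` near `z`. -/
structure IsSibonyCandidate {n : ℕ} (D : Set (EuclideanSpace ℂ (Fin n)))
    (z : EuclideanSpace ℂ (Fin n)) (v : EuclideanSpace ℂ (Fin n) → ℝ) : Prop where
  mapsTo : MapsTo v D (Ico 0 1)
  eq_zero : v z = 0
  log_psh : IsPlurisubharmonicOn (fun w => ENNReal.log (ENNReal.ofReal (v w))) D
  contDiffAt : ContDiffAt ℝ 2 v z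

/-- The Sibony metric `S_D(z; X)`, as a supremum in `[0, ∞]`. -/
def sibonyMetric {n : ℕ} (D : Set (EuclideanSpace ℂ (Fin n)))
    (z X : EuclideanSpace ℂ (Fin n)) : ℝ≥0∞ :=
  ⨆ (v : EuclideanSpace ℂ (Fin n) → ℝ) (_ : IsSibonyCandidate D z v),
    ENNReal.ofReal (Real.sqrt (leviForm v z X))

/-- The indicatrix `{X ∈ ℂⁿ : S_D(z; X) < 1}` of the Sibony metric. -/
def sibonyIndicatrix {n : ℕ} (D : Set (EuclideanSpace ℂ (Fin n)))
    (z : EuclideanSpace ℂ (Fin n)) : Set (EuclideanSpace ℂ (Fin n)) :=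
  {X | sibonyMetric D z X < 1}

/-- The boundary of `D` is of class `C¹` near `p`: in an open neighbourhood `U` of `p`, the set `D`
is given by `ρ < 0` for a `C¹` function `ρ : U → ℝ` with nowhere vanishing differential. -/
def HasC1BoundaryNear {n : ℕ} (D : Set (EuclideanSpace ℂ (Fin n)))
    (p : EuclideanSpace ℂ (Fin n)) : Prop :=
  ∃ (U : Set (EuclideanSpace ℂ (Fin n))) (ρ : EuclideanSpace ℂ (Fin n) → ℝ),
    IsOpen U ∧ p ∈ U ∧ ContDiffOn ℝ 1 ρ U ∧ (∀ z ∈ U, fderiv ℝ ρ z ≠ 0) ∧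
      D ∩ U = {z ∈ U | ρ z < 0}

end

/-! Near `p` the domain is almost a half space. Let `L` be the complex-linear functional with real
part `dρ_p`, and `d = -ρ z`. For fixed `η > 0` and `z` close to `p`, strict differentiability of `ρ`
gives `Re L (w - z) < 2d` for `w ∈ D` within `τ = d / η` of `z`. A Möbius map of this half plane
then yields a holomorphic `F` with `F z = 0`, `‖F‖ ≤ 1` and derivative `L / (4d)` at `z`.
`exists_isSibonyCandidate` globalizes `F`: the maximum of `A‖F‖² + B‖w - z‖²` and `(‖w - z‖ / R) ^
c`, with `c` slightly above 2, is the first function near `z` and the second near the sphere of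
radius `τ`. Taking `A` proportional to `τ²` makes the Levi form at least a multiple of `‖L X‖² /
η²`, free of `d`. The indicatrix therefore lies in a bounded slab of width `O(η)` about `ker L`
(`sibonyIndicatrix_subset_slab`), whose volume tends to 0 with `η` (`tendsto_volume_slab`). -/

/-! ### Circular means and the sub-mean value inequality for `log v` -/

theorem angularMean_mono {g₁ g₂ : ℝ → EReal} (h : ∀ t, g₁ t ≤ g₂ t) :
    angularMean g₁ ≤ angularMean g₂ := by
  unfold angularMean
  apply EReal.sub_le_sub
  · exact EReal.coe_ennreal_le_coe_ennreal_iff.2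
      (lintegral_mono fun t => EReal.toENNReal_le_toENNReal (h t))
  · exact EReal.coe_ennreal_le_coe_ennreal_iff.2
      (lintegral_mono fun t => EReal.toENNReal_le_toENNReal (EReal.neg_le_neg_iff.2 (h t)))

theorem angularMean_coe {g : ℝ → ℝ} (hg : Continuous g) :
    angularMean (fun t => (g t : EReal)) =
      ((⨍ t in Ioc 0 (2 * Real.pi), g t : ℝ) : EReal) := by
  have hi : Integrable g (((volume.restrict (Ioc 0 (2 * Real.pi))) univ)⁻¹ •
      (volume.restrict (Ioc 0 (2 * Real.pi)))) := by
    apply Integrable.smul_measure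
    · exact (hg.integrableOn_Icc).mono_set Ioc_subset_Icc_self
    · simp [Real.pi_pos]
  unfold angularMean laverage average
  rw [integral_eq_lintegral_pos_part_sub_lintegral_neg_part hi]
  have h1 := hi.lintegral_lt_top
  have h2 := hi.neg.lintegral_lt_top
  simp only [Pi.neg_apply] at h2
  have e : ∀ x : ℝ, (x : EReal).toENNReal = ENNReal.ofReal x := fun x => by simp
  have e' : ∀ x : ℝ, (-(x : EReal)).toENNReal = ENNReal.ofReal (-x) := fun x => by
    rw [← EReal.coe_neg, e]
  simp only [e, e', EReal.coe_sub]
  rw [EReal.coe_ennreal_toReal h1.ne, EReal.coe_ennreal_toReal h2.ne]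

/-- The logarithm of the modulus of a zero-free holomorphic function is harmonic. The factor `c`
serves the powers `‖φ‖ ^ c`. -/
theorem angularMean_log_norm {φ : ℂ → ℂ} {R r : ℝ} (hr : 0 < r) (hrR : r < R)
    (hφ : DifferentiableOn ℂ φ (Metric.ball 0 R)) (h0 : ∀ ζ ∈ Metric.ball (0 : ℂ) R, φ ζ ≠ 0)
    (c : ℝ) :
    angularMean (fun t => ((c * Real.log ‖φ (circleMap 0 r t)‖ : ℝ) : EReal)) =
      ((c * Real.log ‖φ 0‖ : ℝ) : EReal) := by
  have hmem : ∀ t, circleMap 0 r t ∈ Metric.ball (0 : ℂ) R := fun t => by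
    simpa [abs_of_pos hr] using hrR
  have hc : Continuous fun t => φ (circleMap 0 r t) :=
    hφ.continuousOn.comp_continuous (continuous_circleMap 0 r) hmem
  rw [angularMean_coe]
  · have key := AnalyticOnNhd.circleAverage_log_norm_of_ne_zero (g := φ) (c := 0) (R := r)
      (fun ζ hζ => hφ.analyticAt (Metric.isOpen_ball.mem_nhds
        (Metric.closedBall_subset_ball (by rwa [abs_of_pos hr]) hζ)))
      (fun ζ hζ => h0 ζ (Metric.closedBall_subset_ball (by rwa [abs_of_pos hr]) hζ))
    rw [Real.circleAverage_eq_intervalAverage, uIoc_of_le Real.two_pi_pos.le] at key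
    rw [← key, average, average, integral_const_mul]
  · exact continuous_const.mul (hc.norm.log fun t => norm_ne_zero_iff.2 (h0 _ (hmem t)))

/-- Holomorphic support functions from below give the sub-mean value inequality for `log v`. -/
theorem submean_log_of_holomorphic_support {n : ℕ} {v : EuclideanSpace ℂ (Fin n) → ℝ}
    {a : EuclideanSpace ℂ (Fin n)} (φ : EuclideanSpace ℂ (Fin n) → ℂ) {c : ℝ}
    (hφ : ∀ᶠ w in 𝓝 a, DifferentiableAt ℂ φ w) (h0 : φ a ≠ 0)
    (hle : ∀ᶠ w in 𝓝 a, ‖φ w‖ ^ c ≤ v w) (heq : v a = ‖φ a‖ ^ c) (b : EuclideanSpace ℂ (Fin n)) :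
    ∃ R : ℝ, 0 < R ∧ ∀ r : ℝ, 0 < r → r < R →
      ENNReal.log (ENNReal.ofReal (v a)) ≤
        angularMean fun t => ENNReal.log (ENNReal.ofReal (v (a + (circleMap 0 r t) • b))) := by
  have hlog : ∀ x : ℂ, x ≠ 0 → ENNReal.log (ENNReal.ofReal (‖x‖ ^ c)) =
      ((c * Real.log ‖x‖ : ℝ) : EReal) := fun x hx => by
    have := norm_pos_iff.2 hx
    rw [ENNReal.log_ofReal_of_pos (by positivity), Real.log_rpow this]
  have hl : Tendsto (fun ζ : ℂ => a + ζ • b) (𝓝 0) (𝓝 a) := by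
    have : Continuous fun ζ : ℂ => a + ζ • b := by fun_prop
    simpa using this.tendsto 0
  have hne : ∀ᶠ w in 𝓝 a, φ w ≠ 0 := hφ.self_of_nhds.continuousAt.eventually_ne h0
  obtain ⟨R, hR, hball⟩ := Metric.eventually_nhds_iff_ball.1
    (hl.eventually (hφ.and (hne.and hle)))
  refine ⟨R, hR, fun r hr hrR => ?_⟩
  have hmem : ∀ t, circleMap 0 r t ∈ Metric.ball (0 : ℂ) R := fun t => by
    simpa [abs_of_pos hr] using hrR
  have key := angularMean_log_norm (φ := fun ζ => φ (a + ζ • b)) hr hrR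
    (fun ζ hζ => by
      have h1 : DifferentiableAt ℂ (fun ζ : ℂ => a + ζ • b) ζ := by fun_prop
      exact ((hball ζ hζ).1.comp ζ h1).differentiableWithinAt)
    (fun ζ hζ => (hball ζ hζ).2.1) c
  rw [heq, hlog _ h0]
  calc ((c * Real.log ‖φ a‖ : ℝ) : EReal)
      = angularMean (fun t => ((c * Real.log ‖φ (a + circleMap 0 r t • b)‖ : ℝ) : EReal)) := by
        rw [key]; simp
    _ ≤ _ := angularMean_mono fun t => by
        rw [← hlog _ (hball _ (hmem t)).2.1]
        exact ENNReal.log_le_log (ENNReal.ofReal_le_ofReal (hball _ (hmem t)).2.2)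
-- Levi form and support functions of the two building blocks
open scoped ComplexConjugate

theorem leviForm_weighted_sum {n : ℕ} {v : EuclideanSpace ℂ (Fin n) → ℝ}
    {z : EuclideanSpace ℂ (Fin n)} {F : EuclideanSpace ℂ (Fin n) → ℂ} {A B : ℝ}
    (hF : AnalyticAt ℂ F z) (hF0 : F z = 0)
    (hv : ∀ᶠ w in 𝓝 z, v w = A * ‖F w‖ ^ 2 + B * ‖w - z‖ ^ 2) (X : EuclideanSpace ℂ (Fin n)) :
    leviForm v z X = A * ‖fderiv ℂ F z X‖ ^ 2 + B * ‖X‖ ^ 2 := by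
  have hconj : ∀ x : ℂ, ((‖x‖ ^ 2 : ℝ) : ℂ) = x * conj x := fun x => by
    rw [Complex.mul_conj, Complex.normSq_eq_norm_sq]
  have hv' : ∀ᶠ w in 𝓝 z, ((v w : ℝ) : ℂ) =
      A * (F w * conj (F w)) + B * ∑ i, (w i - z i) * conj (w i - z i) := by
    filter_upwards [hv] with w hw
    rw [hw, EuclideanSpace.norm_sq_eq]
    push_cast
    simp only [← hconj]
    push_cast
    simp
  have hdzbar : ∀ k, ∀ᶠ w in 𝓝 z, dzbar k (fun w => (v w : ℂ)) w =
      A * (F w * conj (fderiv ℂ F w (EuclideanSpace.single k 1))) + B * (w k - z k) := by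
    intro k
    filter_upwards [hv'.eventually_nhds, hF.eventually_analyticAt] with w hw hFw
    have h1 : HasFDerivAt F ((fderiv ℂ F w).restrictScalars ℝ) w :=
      hFw.differentiableAt.hasFDerivAt.restrictScalars ℝ
    have h2 : HasFDerivAt (fun w => conj (F w))
        ((Complex.conjCLE : ℂ →L[ℝ] ℂ).comp ((fderiv ℂ F w).restrictScalars ℝ)) w :=
      (Complex.conjCLE : ℂ →L[ℝ] ℂ).hasFDerivAt.comp w h1
    have h3 : ∀ i, HasFDerivAt (fun w : EuclideanSpace ℂ (Fin n) => w i - z i)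
        ((EuclideanSpace.proj i : EuclideanSpace ℂ (Fin n) →L[ℂ] ℂ).restrictScalars ℝ) w := fun i =>
      (((EuclideanSpace.proj i : EuclideanSpace ℂ (Fin n) →L[ℂ] ℂ).restrictScalars
        ℝ).hasFDerivAt (x := w)).sub_const (z i)
    have h4 : ∀ i, HasFDerivAt (fun w : EuclideanSpace ℂ (Fin n) => conj (w i - z i))
        ((Complex.conjCLE : ℂ →L[ℝ] ℂ).comp
          ((EuclideanSpace.proj i : EuclideanSpace ℂ (Fin n) →L[ℂ] ℂ).restrictScalars ℝ)) w :=
      fun i => (Complex.conjCLE : ℂ →L[ℝ] ℂ).hasFDerivAt.comp w (h3 i)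
    have h5 := ((h1.mul h2).const_mul (A : ℂ)).add
      ((HasFDerivAt.fun_sum (u := Finset.univ) fun i _ => (h3 i).mul (h4 i)).const_mul (B : ℂ))
    have h6 := (h5.congr_of_eventuallyEq hw).fderiv
    unfold dzbar
    have hI : (EuclideanSpace.single k Complex.I : EuclideanSpace ℂ (Fin n)) =
        Complex.I • EuclideanSpace.single k 1 := by
      ext i; simp
    rw [h6, hI]
    simp [Finset.sum_add_distrib, apply_ite conj]
    ring_nf
    simp
    ring
  have hdz : ∀ j k, dz j (dzbar k fun w => (v w : ℂ)) z =
      A * (fderiv ℂ F z (EuclideanSpace.single j 1) *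
        conj (fderiv ℂ F z (EuclideanSpace.single k 1))) + B * (if k = j then 1 else 0) := by
    intro j k
    have h1 : HasFDerivAt F ((fderiv ℂ F z).restrictScalars ℝ) z :=
      hF.differentiableAt.hasFDerivAt.restrictScalars ℝ
    -- Differentiability suffices: in the product rule the derivative of this factor is multiplied
    -- by `F z = 0`.
    have h2 : DifferentiableAt ℝ (fun w => conj (fderiv ℂ F w (EuclideanSpace.single k 1))) z := by
      have : DifferentiableAt ℂ (fun w => fderiv ℂ F w (EuclideanSpace.single k 1)) z :=
        hF.fderiv.differentiableAt.clm_apply (differentiableAt_const _)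
      exact (Complex.conjCLE : ℂ →L[ℝ] ℂ).differentiableAt.comp z (this.restrictScalars ℝ)
    have h3 : HasFDerivAt (fun w : EuclideanSpace ℂ (Fin n) => w k - z k)
        ((EuclideanSpace.proj k : EuclideanSpace ℂ (Fin n) →L[ℂ] ℂ).restrictScalars ℝ) z :=
      (((EuclideanSpace.proj k : EuclideanSpace ℂ (Fin n) →L[ℂ] ℂ).restrictScalars
        ℝ).hasFDerivAt (x := z)).sub_const (z k)
    have h5 := ((h1.mul h2.hasFDerivAt).const_mul (A : ℂ)).add (h3.const_mul (B : ℂ))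
    have h6 := (h5.congr_of_eventuallyEq (hdzbar k)).fderiv
    have hI : (EuclideanSpace.single j Complex.I : EuclideanSpace ℂ (Fin n)) =
        Complex.I • EuclideanSpace.single j 1 := by
      ext i; simp
    unfold dz
    rw [h6, hI]
    simp [hF0]
    split_ifs <;>
    · ring_nf
      simp
      ring
  have hX : fderiv ℂ F z X = ∑ j, fderiv ℂ F z (EuclideanSpace.single j 1) * X j := by
    conv_lhs => rw [← (EuclideanSpace.basisFun (Fin n) ℂ).sum_repr X]
    simp [mul_comm]
  have : ((A * ‖fderiv ℂ F z X‖ ^ 2 + B * ‖X‖ ^ 2 : ℝ) : ℂ) =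
      ∑ j, ∑ k, dz j (dzbar k fun w => (v w : ℂ)) z * X j * conj (X k) := by
    rw [EuclideanSpace.norm_sq_eq, Complex.ofReal_add, Complex.ofReal_mul, Complex.ofReal_mul,
      hconj, Complex.ofReal_sum, hX]
    simp only [hconj, hdz, map_sum, map_mul, add_mul, Finset.sum_add_distrib]
    congr 1
    · rw [Finset.sum_mul_sum, Finset.mul_sum]
      refine Finset.sum_congr rfl fun j _ => ?_
      rw [Finset.mul_sum]
      refine Finset.sum_congr rfl fun k _ => ?_
      ring
    · rw [Finset.mul_sum]
      refine Finset.sum_congr rfl fun j _ => ?_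
      simp [mul_assoc]
  rw [leviForm, ← this, Complex.ofReal_re]

/-- Cauchy–Schwarz for the vectors `(√A x, √B X)` and `(√A y, √B Y)`. -/
theorem cauchySchwarz_weighted_sum {n : ℕ} {A B : ℝ} (hA : 0 ≤ A) (hB : 0 ≤ B) (x y : ℂ)
    (X Y : EuclideanSpace ℂ (Fin n)) :
    ‖A * conj x * y + B * inner ℂ X Y‖ ^ 2 ≤
      (A * ‖x‖ ^ 2 + B * ‖X‖ ^ 2) * (A * ‖y‖ ^ 2 + B * ‖Y‖ ^ 2) := by
  have h1 : ‖A * conj x * y + B * inner ℂ X Y‖ ≤ A * ‖x‖ * ‖y‖ + B * (‖X‖ * ‖Y‖) := by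
    refine (norm_add_le _ _).trans (add_le_add ?_ ?_)
    · simp [abs_of_nonneg hA]
    · rw [norm_mul, Complex.norm_real, Real.norm_of_nonneg hB]
      exact mul_le_mul_of_nonneg_left (norm_inner_le_norm X Y) hB
  calc _ ≤ (A * ‖x‖ * ‖y‖ + B * (‖X‖ * ‖Y‖)) ^ 2 := by gcongr
    _ ≤ _ := by nlinarith [mul_nonneg (mul_nonneg hA hB) (sq_nonneg (‖x‖ * ‖Y‖ - ‖y‖ * ‖X‖))]

/-- The sub-mean value inequality at a point where `v` touches `A ‖F‖² + B ‖· - z‖²` from above. -/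
theorem submean_log_of_weighted_sum_le {n : ℕ} {v : EuclideanSpace ℂ (Fin n) → ℝ}
    {a z : EuclideanSpace ℂ (Fin n)} {F : EuclideanSpace ℂ (Fin n) → ℂ} {A B : ℝ} (hA : 0 ≤ A)
    (hB : 0 ≤ B) (hF : AnalyticAt ℂ F a) (hva : v a = A * ‖F a‖ ^ 2 + B * ‖a - z‖ ^ 2)
    (hpos : 0 < v a) (hle : ∀ᶠ w in 𝓝 a, A * ‖F w‖ ^ 2 + B * ‖w - z‖ ^ 2 ≤ v w)
    (b : EuclideanSpace ℂ (Fin n)) :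
    ∃ R : ℝ, 0 < R ∧ ∀ r : ℝ, 0 < r → r < R →
      ENNReal.log (ENNReal.ofReal (v a)) ≤
        angularMean fun t => ENNReal.log (ENNReal.ofReal (v (a + (circleMap 0 r t) • b))) := by
  -- The sum is the squared norm of the holomorphic map `(√A F, √B (w - z))`; `φ` is the component
  -- of this map along its value at `a`.
  set φ : EuclideanSpace ℂ (Fin n) → ℂ := fun w =>
    (A * conj (F a) * F w + B * inner ℂ (a - z) (w - z)) / (Real.sqrt (v a) : ℝ) with hφdef
  have hs : 0 < Real.sqrt (v a) := Real.sqrt_pos.2 hpos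
  have hφa : φ a = (Real.sqrt (v a) : ℝ) := by
    have hc : ((Real.sqrt (v a) : ℝ) : ℂ) ≠ 0 := by exact_mod_cast hs.ne'
    have : (A * conj (F a) * F a + B * inner ℂ (a - z) (a - z) : ℂ) = (v a : ℝ) := by
      rw [hva, inner_self_eq_norm_sq_to_K, mul_assoc, mul_comm (conj (F a)), Complex.mul_conj,
        Complex.normSq_eq_norm_sq]
      push_cast
      rfl
    simp only [hφdef]
    rw [this, div_eq_iff hc, ← Complex.ofReal_mul, Real.mul_self_sqrt hpos.le]
  refine submean_log_of_holomorphic_support φ (c := 2) ?_ ?_ ?_ ?_ b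
  · filter_upwards [hF.eventually_analyticAt] with w hw
    have h1 := hw.differentiableAt
    have h2 : DifferentiableAt ℂ (fun w => inner ℂ (a - z) (w - z)) w :=
      (innerSL ℂ (a - z)).differentiableAt.comp w (differentiableAt_id.sub_const z)
    simp only [hφdef]
    fun_prop
  · rw [hφa]; exact_mod_cast hs.ne'
  · filter_upwards [hle] with w hw
    refine le_trans ?_ hw
    rw [Real.rpow_two]
    simp only [hφdef]
    rw [norm_div, div_pow, Complex.norm_real, Real.norm_of_nonneg hs.le, Real.sq_sqrt hpos.le,
      div_le_iff₀ hpos, hva, mul_comm (_ + _)]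
    exact cauchySchwarz_weighted_sum hA hB (F a) (F w) (a - z) (w - z)
  · rw [hφa, Real.rpow_two, Complex.norm_real, Real.norm_of_nonneg hs.le, Real.sq_sqrt hpos.le]

/-- The sub-mean value inequality at a point where `v` touches a power of `‖· - z‖` from above. -/
theorem submean_log_of_norm_rpow_le {n : ℕ} {v : EuclideanSpace ℂ (Fin n) → ℝ}
    {a z : EuclideanSpace ℂ (Fin n)} {R c : ℝ} (hR : 0 < R) (hc : 0 ≤ c) (haz : a ≠ z)
    (hva : v a = (‖a - z‖ / R) ^ c) (hle : ∀ w, (‖w - z‖ / R) ^ c ≤ v w)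
    (b : EuclideanSpace ℂ (Fin n)) :
    ∃ R : ℝ, 0 < R ∧ ∀ r : ℝ, 0 < r → r < R →
      ENNReal.log (ENNReal.ofReal (v a)) ≤
        angularMean fun t => ENNReal.log (ENNReal.ofReal (v (a + (circleMap 0 r t) • b))) := by
  have hs : 0 < ‖a - z‖ := norm_pos_iff.2 (sub_ne_zero.2 haz)
  set φ : EuclideanSpace ℂ (Fin n) → ℂ := fun w =>
    inner ℂ (a - z) (w - z) / ((‖a - z‖ * R : ℝ) : ℂ) with hφdef
  have hφ : ∀ w, ‖φ w‖ = ‖inner ℂ (a - z) (w - z)‖ / (‖a - z‖ * R) := fun w => by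
    simp only [hφdef]
    rw [norm_div, Complex.norm_real, Real.norm_of_nonneg (by positivity)]
  have hφa : ‖φ a‖ = ‖a - z‖ / R := by
    rw [hφ, inner_self_eq_norm_sq_to_K, norm_pow, RCLike.norm_ofReal, abs_norm]; field_simp
  refine submean_log_of_holomorphic_support φ (c := c) ?_ ?_ ?_ ?_ b
  · refine Eventually.of_forall fun w => ?_
    have h2 : DifferentiableAt ℂ (fun w => inner ℂ (a - z) (w - z)) w :=
      (innerSL ℂ (a - z)).differentiableAt.comp w (differentiableAt_id.sub_const z)
    simp only [hφdef]
    fun_prop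
  · rw [← norm_ne_zero_iff, hφa]; positivity
  · refine Eventually.of_forall fun w => le_trans ?_ (hle w)
    refine Real.rpow_le_rpow (norm_nonneg _) ?_ hc
    rw [hφ, div_le_div_iff₀ (by positivity) hR]
    nlinarith [norm_inner_le_norm (𝕜 := ℂ) (a - z) (w - z)]
  · rw [hφa, hva]

/-! ### Gluing a local function into a global competitor -/

/-- A bounded holomorphic function `F` on the part of `D` in a ball of radius `τ` about `z`, with
`F z = 0`, yields a competitor for the Sibony metric on all of `D`. -/
theorem exists_isSibonyCandidate {n : ℕ} {D : Set (EuclideanSpace ℂ (Fin n))}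
    {z : EuclideanSpace ℂ (Fin n)} (hz : z ∈ D) {τ R : ℝ} (hτ : 0 < τ) (hτR : τ ≤ R)
    (hR : ∀ w ∈ D, ‖w - z‖ < R) {F : EuclideanSpace ℂ (Fin n) → ℂ}
    (hF : ∀ w ∈ D, ‖w - z‖ < τ → AnalyticAt ℂ F w) (hF1 : ∀ w ∈ D, ‖w - z‖ < τ → ‖F w‖ ≤ 1)
    (hF0 : F z = 0) :
    ∃ v, IsSibonyCandidate D z v ∧ ∀ X, leviForm v z X =
      (1 / (8 * R ^ 2)) * τ ^ 2 * ‖fderiv ℂ F z X‖ ^ 2 + 1 / (8 * R ^ 2) * ‖X‖ ^ 2 := by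
  have hRpos : 0 < R := hτ.trans_le hτR
  set B : ℝ := 1 / (8 * R ^ 2) with hB
  have hBpos : 0 < B := by positivity
  have hBR : B * R ^ 2 = 1 / 8 := by rw [hB]; field_simp
  set A : ℝ := B * τ ^ 2 with hA
  have hApos : 0 < A := by positivity
  -- `c > 2` makes the power negligible against `B‖w - z‖²` near `z`. On the sphere the power must
  -- exceed `A + Bτ² = 2Bτ² = (τ / R)² / 4`, which holds at `c = 2` and hence slightly beyond.
  obtain ⟨c, hc2, hcτ⟩ : ∃ c : ℝ, 2 < c ∧ 2 * B * τ ^ 2 < (τ / R) ^ c := by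
    have h1 : ContinuousAt (fun c : ℝ => (τ / R) ^ c) 2 :=
      (Real.continuousAt_const_rpow (by positivity))
    have h2 : 2 * B * τ ^ 2 < (τ / R) ^ (2 : ℝ) := by
      rw [Real.rpow_two, div_pow, lt_div_iff₀ (by positivity)]
      nlinarith [sq_pos_of_pos hτ]
    have h3 : ∀ᶠ c in 𝓝[>] (2 : ℝ), 2 * B * τ ^ 2 < (τ / R) ^ c :=
      (h1.eventually (lt_mem_nhds h2)).filter_mono nhdsWithin_le_nhds
    obtain ⟨c, hc⟩ := (h3.and self_mem_nhdsWithin).exists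
    exact ⟨c, hc.2, hc.1⟩
  have hc0 : 0 < c := by linarith
  set h : EuclideanSpace ℂ (Fin n) → ℝ := fun w => A * ‖F w‖ ^ 2 + B * ‖w - z‖ ^ 2 with hh
  set g : EuclideanSpace ℂ (Fin n) → ℝ := fun w => (‖w - z‖ / R) ^ c with hg
  set v : EuclideanSpace ℂ (Fin n) → ℝ := fun w =>
    if ‖w - z‖ < τ then max (h w) (g w) else g w with hv
  have hgc : Continuous g :=
    ((continuous_id.sub continuous_const).norm.div_const R).rpow_const fun _ => Or.inr hc0.le
  have hhz : h z = 0 := by simp [hh, hF0]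
  have hnear : ∀ a : EuclideanSpace ℂ (Fin n), ‖a - z‖ < τ → ∀ᶠ w in 𝓝 a, ‖w - z‖ < τ :=
    fun a ha => (continuous_id.sub continuous_const).norm.continuousAt.eventually (gt_mem_nhds ha)
  have hgv : ∀ w, g w ≤ v w := fun w => by
    simp only [hv]; split_ifs
    · exact le_max_right _ _
    · exact le_rfl
  have hg0 : ∀ w, 0 ≤ g w := fun w => by simp only [hg]; positivity
  have hvh : ∀ᶠ w in 𝓝 z, v w = h w := by
    have h1 : ContinuousAt (fun w : EuclideanSpace ℂ (Fin n) => (‖w - z‖ / R) ^ (c - 2)) z :=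
      (((continuous_id.sub continuous_const).norm.div_const R).rpow_const
        fun _ => Or.inr (by linarith)).continuousAt
    have h2 : (‖z - z‖ / R) ^ (c - 2) < 1 / 8 := by
      rw [sub_self, norm_zero, zero_div, Real.zero_rpow (by linarith)]; norm_num
    filter_upwards [h1.eventually (gt_mem_nhds h2), hnear z (by simpa using hτ)] with w hw hw'
    simp only [hv, if_pos hw']
    refine max_eq_left ?_
    have h3 : g w = (‖w - z‖ / R) ^ (c - 2) * (‖w - z‖ / R) ^ 2 := by
      simp only [hg]
      rw [← Real.rpow_two, ← Real.rpow_add_of_nonneg (by positivity) (by linarith) (by norm_num)]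
      congr 1; ring
    have h4 : (1 / 8) * (‖w - z‖ / R) ^ 2 = B * ‖w - z‖ ^ 2 := by rw [hB]; field_simp
    rw [h3]
    calc _ ≤ (1 / 8) * (‖w - z‖ / R) ^ 2 := by gcongr
      _ ≤ _ := by rw [h4]; simp only [hh]; nlinarith [sq_nonneg ‖F w‖]
  have hhle : ∀ w ∈ D, ‖w - z‖ < τ → h w ≤ A + B * ‖w - z‖ ^ 2 := fun w hw hwτ => by
    have h1 : ‖F w‖ ^ 2 ≤ 1 := pow_le_one₀ (norm_nonneg _) (hF1 w hw hwτ)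
    simp only [hh]; nlinarith
  have hhlt : ∀ w ∈ D, ‖w - z‖ < τ → h w < 1 := fun w hw hwτ => by
    have h1 := hhle w hw hwτ
    have h2 : ‖w - z‖ ^ 2 ≤ R ^ 2 := by gcongr; exact hwτ.le.trans hτR
    have h3 : τ ^ 2 ≤ R ^ 2 := by gcongr
    nlinarith
  have hglt : ∀ w ∈ D, g w < 1 := fun w hw =>
    Real.rpow_lt_one (by positivity) ((div_lt_one hRpos).2 (hR w hw)) hc0
  have hcont : ContinuousOn v D := by
    intro a ha
    rcases lt_trichotomy ‖a - z‖ τ with haτ | haτ | haτ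
    · have h1 : ContinuousAt (fun w => max (h w) (g w)) a := by
        have := (hF a ha haτ).continuousAt
        have h2 : ContinuousAt h a := by
          simp only [hh]
          fun_prop
        exact h2.sup hgc.continuousAt
      refine (h1.congr ?_).continuousWithinAt
      filter_upwards [hnear a haτ] with w hw
      simp [hv, hw]
    -- Nothing is known of `F` on the sphere itself, so `h` is replaced by its continuous upper
    -- bound.
    · have h1 : ∀ᶠ w in 𝓝 a, A + B * ‖w - z‖ ^ 2 < g w := by
        refine ContinuousAt.eventually_lt (by fun_prop) hgc.continuousAt ?_
        simp only [hg, haτ]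
        linarith
      have h2 : ∀ w ∈ D, A + B * ‖w - z‖ ^ 2 < g w → v w = g w := fun w hw hlt => by
        simp only [hv]
        split_ifs with hwτ
        · exact max_eq_right ((hhle w hw hwτ).trans hlt.le)
        · rfl
      refine hgc.continuousWithinAt.congr_of_eventuallyEq ?_ (h2 a ha h1.self_of_nhds)
      filter_upwards [self_mem_nhdsWithin, h1.filter_mono nhdsWithin_le_nhds] with w hw hw'
      exact h2 w hw hw'
    · have h1 : ∀ᶠ w in 𝓝 a, τ < ‖w - z‖ :=
        (continuous_id.sub continuous_const).norm.continuousAt.eventually (lt_mem_nhds haτ)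
      refine (hgc.continuousAt.congr ?_).continuousWithinAt
      filter_upwards [h1] with w hw
      simp [hv, hw.not_gt]
  refine ⟨v, ⟨fun w hw => ⟨(hg0 w).trans (hgv w), ?_⟩, ?_, ⟨?_, ?_, ?_⟩, ?_⟩, fun X => ?_⟩
  · simp only [hv]
    split_ifs with hwτ
    · exact max_lt (hhlt w hw hwτ) (hglt w hw)
    · exact hglt w hw
  · rw [hvh.self_of_nhds, hhz]
  · intro w _
    exact ENNReal.log_lt_top_iff.2 ENNReal.ofReal_lt_top
  · exact (ENNReal.continuous_log.comp_continuousOn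
      (ENNReal.continuous_ofReal.comp_continuousOn hcont)).upperSemicontinuousOn
  · intro a ha b
    have hva0 : 0 ≤ v a := (hg0 a).trans (hgv a)
    rcases hva0.eq_or_lt with h0 | hpos
    · exact ⟨1, one_pos, fun r _ _ => by simp [← h0]⟩
    -- Whichever branch attains `v a` lies below `v` near `a`, so its support function serves for
    -- `v`.
    by_cases hag : v a = g a
    · refine submean_log_of_norm_rpow_le hRpos hc0.le ?_ hag hgv b
      rintro rfl
      rw [hag] at hpos
      simp [hg, Real.zero_rpow hc0.ne'] at hpos
    · have haτ : ‖a - z‖ < τ := by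
        by_contra hcon
        exact hag (by simp [hv, hcon])
      have hah : v a = h a := by
        have h1 : v a = max (h a) (g a) := by simp [hv, haτ]
        rcases max_choice (h a) (g a) with h2 | h2
        · rw [h1, h2]
        · exact absurd (h1.trans h2) hag
      refine submean_log_of_weighted_sum_le hApos.le hBpos.le (hF a ha haτ) hah hpos ?_ b
      filter_upwards [hnear a haτ] with w hw
      simp only [hv, if_pos hw]
      exact le_max_left _ _
  · have hFz : ContDiffAt ℝ 2 F z := (hF z hz (by simpa using hτ)).contDiffAt.restrict_scalars ℝ
    have h1 : ContDiffAt ℝ 2 h z :=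
      (contDiffAt_const.mul (hFz.norm_sq ℝ)).add
        (contDiffAt_const.mul ((contDiffAt_id.sub contDiffAt_const).norm_sq ℂ))
    exact h1.congr_of_eventuallyEq hvh
  · exact leviForm_weighted_sum (hF z hz (by simpa using hτ)) hF0 hvh X

/-! ### The indicatrix in a thin slab -/

theorem leviForm_lt_one_of_mem_sibonyIndicatrix {n : ℕ} {D : Set (EuclideanSpace ℂ (Fin n))}
    {z X : EuclideanSpace ℂ (Fin n)} {v : EuclideanSpace ℂ (Fin n) → ℝ}
    (hv : IsSibonyCandidate D z v) (hX : X ∈ sibonyIndicatrix D z) : leviForm v z X < 1 := by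
  have h1 : ENNReal.ofReal (Real.sqrt (leviForm v z X)) < 1 :=
    (le_iSup₂ (f := fun v (_ : IsSibonyCandidate D z v) =>
      ENNReal.ofReal (Real.sqrt (leviForm v z X))) v hv).trans_lt hX
  rw [← ENNReal.ofReal_one, ENNReal.ofReal_lt_ofReal_iff one_pos] at h1
  exact (Real.sqrt_lt' one_pos).1 h1 |>.trans_eq (one_pow 2)

/-- If `D` lies in the half space `Re L (w - z) < 2 d` near `z`, the indicatrix at `z` is contained
in a slab around `ker L`. -/
theorem sibonyIndicatrix_subset_slab {n : ℕ} {D : Set (EuclideanSpace ℂ (Fin n))}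
    {z : EuclideanSpace ℂ (Fin n)} (hz : z ∈ D) (L : EuclideanSpace ℂ (Fin n) →L[ℂ] ℂ)
    {d η R : ℝ} (hd : 0 < d) (hη : 0 < η) (hdR : d / η ≤ R) (hR : ∀ w ∈ D, ‖w - z‖ < R)
    (hL : ∀ w ∈ D, ‖w - z‖ < d / η → (L (w - z)).re < 2 * d) :
    sibonyIndicatrix D z ⊆ {X | ‖X‖ ≤ 3 * R ∧ ‖L X‖ ≤ 12 * R * η} := by
  have hRpos : 0 < R := (div_pos hd hη).trans_le hdR
  have hne : ∀ w ∈ D, ‖w - z‖ < d / η → (4 * d : ℂ) - L (w - z) ≠ 0 := fun w hw hwτ h0 => by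
    have h1 := congrArg Complex.re h0
    have h2 := hL w hw hwτ
    simp at h1
    simp at h2
    linarith
  have hzτ : ‖z - z‖ < d / η := by simpa using div_pos hd hη
  -- `ζ ↦ ζ / (4d - ζ)` maps `Re ζ < 2d` into the unit disc, since there `ζ` is nearer to `0` than
  -- to `4d`.
  obtain ⟨v, hv, hlevi⟩ := exists_isSibonyCandidate hz (div_pos hd hη) hdR hR
    (F := fun w => L (w - z) / (4 * d - L (w - z)))
    (fun w hw hwτ => by
      have h1 : AnalyticAt ℂ (fun w => L (w - z)) w :=
        (L.analyticAt _).fun_comp (analyticAt_id.sub analyticAt_const)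
      exact h1.div (analyticAt_const.sub h1) (hne w hw hwτ))
    (fun w hw hwτ => by
      rw [norm_div]
      refine div_le_one_of_le₀ ?_ (norm_nonneg _)
      have h2 := hL w hw hwτ
      rw [Complex.norm_def, Complex.norm_def]
      refine Real.sqrt_le_sqrt ?_
      generalize L (w - z) = x at h2
      simp only [Complex.normSq_apply, Complex.sub_re, Complex.sub_im, Complex.mul_re,
        Complex.mul_im, Complex.ofReal_re, Complex.ofReal_im, Complex.re_ofNat, Complex.im_ofNat]
      nlinarith)
    (by simp)
  have hderiv : ∀ X, fderiv ℂ (fun w => L (w - z) / (4 * d - L (w - z))) z X = L X / (4 * d) := by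
    intro X
    have h1 : HasFDerivAt (fun w => L (w - z)) L z :=
      L.hasFDerivAt.comp z ((hasFDerivAt_id z).sub_const z)
    have hd0 : (d : ℂ) ≠ 0 := by exact_mod_cast hd.ne'
    have h2 : HasDerivAt (fun ζ : ℂ => ζ / (4 * d - ζ)) (1 / (4 * d)) (L (z - z)) := by
      have h4d : (4 * d - L (z - z) : ℂ) ≠ 0 := hne z hz hzτ
      convert! (hasDerivAt_id (L (z - z))).div ((hasDerivAt_id (L (z - z))).const_sub (4 * d : ℂ))
        h4d using 1
      simp
      field_simp
    have h3 : HasFDerivAt (fun w => L (w - z) / (4 * d - L (w - z))) ((1 / (4 * d) : ℂ) • L) z := by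
      have h4 := h2.comp_hasFDerivAt z h1
      exact h4
    rw [h3.fderiv]
    simp [div_eq_inv_mul]
  intro X hX
  have h1 := leviForm_lt_one_of_mem_sibonyIndicatrix hv hX
  rw [hlevi, hderiv, norm_div] at h1
  have h2 : ‖(4 * d : ℂ)‖ = 4 * d := by simp [abs_of_pos hd]
  rw [h2] at h1
  -- The radius `d / η` cancels the `d` in the derivative of `F`.
  have h3 : 1 / (8 * R ^ 2) * (d / η) ^ 2 * (‖L X‖ / (4 * d)) ^ 2 =
      ‖L X‖ ^ 2 / (128 * R ^ 2 * η ^ 2) := by field_simp; ring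
  have h4 : 1 / (8 * R ^ 2) * ‖X‖ ^ 2 = ‖X‖ ^ 2 / (8 * R ^ 2) := by ring
  rw [h3, h4] at h1
  have h5 : 0 ≤ ‖L X‖ ^ 2 / (128 * R ^ 2 * η ^ 2) := by positivity
  have h6 : 0 ≤ ‖X‖ ^ 2 / (8 * R ^ 2) := by positivity
  have h7 : ‖L X‖ ^ 2 < 128 * R ^ 2 * η ^ 2 := by
    rw [← div_lt_one (by positivity)]; linarith
  have h8 : ‖X‖ ^ 2 < 8 * R ^ 2 := by
    rw [← div_lt_one (by positivity)]; linarith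
  constructor
  · refine (sq_le_sq₀ (norm_nonneg _) (by positivity)).1 ?_
    nlinarith [sq_pos_of_pos hRpos]
  · refine (sq_le_sq₀ (norm_nonneg _) (by positivity)).1 ?_
    nlinarith [mul_pos (sq_pos_of_pos hRpos) (sq_pos_of_pos hη)]

/-- For `c > 0` the slabs have finite volume and decrease to a part of `ker L`, a proper real
subspace and so a null set; continuity from above applies. -/
theorem tendsto_volume_slab {n : ℕ} (L : EuclideanSpace ℂ (Fin n) →L[ℂ] ℂ) (hL : L ≠ 0)
    (r c : ℝ) :
    Tendsto (fun η : ℝ => volume {X : EuclideanSpace ℂ (Fin n) | ‖X‖ ≤ r ∧ ‖L X‖ ≤ c * η})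
      (𝓝[>] 0) (𝓝 0) := by
  wlog hc : 0 < c generalizing c
  · refine tendsto_of_tendsto_of_tendsto_of_le_of_le' tendsto_const_nhds (this 1 one_pos)
      (Eventually.of_forall fun _ => zero_le) ?_
    filter_upwards [self_mem_nhdsWithin] with η hη
    refine measure_mono fun X hX => ⟨hX.1, hX.2.trans ?_⟩
    have : 0 < η := hη
    nlinarith
  set S : ℝ → Set (EuclideanSpace ℂ (Fin n)) := fun η => {X | ‖X‖ ≤ r ∧ ‖L X‖ ≤ c * η} with hS
  have hclosed : ∀ η, IsClosed (S η) := fun η =>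
    (isClosed_le continuous_norm continuous_const).inter
      (isClosed_le L.continuous.norm continuous_const)
  have hfin : ∀ η, volume (S η) ≠ ∞ := fun η => by
    refine ((measure_mono ?_).trans_lt
      (measure_closedBall_lt_top (x := (0 : EuclideanSpace ℂ (Fin n))) (r := r))).ne
    intro X hX
    simpa using hX.1
  have key := tendsto_measure_biInter_gt (μ := volume) (s := S) (a := 0)
    (fun η _ => (hclosed η).nullMeasurableSet)
    (fun i j _ hij X hX => ⟨hX.1, hX.2.trans (by gcongr)⟩) ⟨1, one_pos, hfin 1⟩
  have hzero : volume (⋂ η > 0, S η) = 0 := by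
    set K : Submodule ℝ (EuclideanSpace ℂ (Fin n)) := (LinearMap.ker L.toLinearMap).restrictScalars ℝ
      with hK
    have hKtop : K ≠ ⊤ := by
      intro h
      refine hL (ContinuousLinearMap.ext fun X => ?_)
      have : X ∈ K := h ▸ Submodule.mem_top
      simpa [hK] using this
    refine measure_mono_null ?_ (Measure.addHaar_submodule volume K hKtop)
    intro X hX
    have h1 : ∀ η : ℝ, 0 < η → ‖L X‖ ≤ c * η := fun η hη => (mem_iInter₂.1 hX η hη).2
    have h2 : ‖L X‖ ≤ 0 := le_of_forall_pos_le_add fun ε hε => by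
      have := h1 (ε / c) (by positivity)
      rwa [mul_div_cancel₀ _ hc.ne', ← zero_add ε] at this
    simpa [hK] using h2
  rw [hzero] at key
  exact key

/-! ### The half-space estimate near `p` -/

theorem proposition3 {n : ℕ} (D : Set (EuclideanSpace ℂ (Fin n))) (hD_open : IsOpen D)
    (hD_conn : IsConnected D) (hD_bdd : Bornology.IsBounded D)
    (p : EuclideanSpace ℂ (Fin n)) (hp : p ∈ frontier D) (hC1 : HasC1BoundaryNear D p) :
    Tendsto (fun z => volume (sibonyIndicatrix D z)) (𝓝[D] p) (𝓝 0) := by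
  obtain ⟨U, ρ, hU, hpU, hρ, hdρ, hDU⟩ := hC1
  have hρp : ContDiffAt ℝ 1 ρ p := hρ.contDiffAt (hU.mem_nhds hpU)
  have hstrict := hρp.hasStrictFDerivAt one_ne_zero
  set L : EuclideanSpace ℂ (Fin n) →L[ℂ] ℂ :=
    StrongDual.extendRCLike (𝕜 := ℂ) (fderiv ℝ ρ p) with hLdef
  have hLre : ∀ X, (L X).re = fderiv ℝ ρ p X := fun X =>
    StrongDual.re_extendRCLike_apply (𝕜 := ℂ) (fderiv ℝ ρ p) X
  have hL : L ≠ 0 := by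
    intro h
    refine hdρ p hpU (ContinuousLinearMap.ext fun X => ?_)
    rw [← hLre, h]
    simp
  have hneg : ∀ z ∈ D, z ∈ U → ρ z < 0 := fun z hz hzU => by
    have : z ∈ D ∩ U := ⟨hz, hzU⟩
    rw [hDU] at this
    exact this.2
  have hUD : ∀ᶠ z in 𝓝[D] p, z ∈ U := mem_nhdsWithin_of_mem_nhds (hU.mem_nhds hpU)
  have hpD : p ∉ D := fun h => by
    rw [hD_open.frontier_eq] at hp
    exact hp.2 h
  have : (𝓝[D] p).NeBot := mem_closure_iff_nhdsWithin_neBot.1 hp.1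
  have hρtend : Tendsto ρ (𝓝[D] p) (𝓝 (ρ p)) := hρp.continuousAt.tendsto.mono_left nhdsWithin_le_nhds
  have hρ0 : ρ p = 0 := by
    refine le_antisymm (le_of_tendsto hρtend ?_) ?_
    · filter_upwards [hUD, self_mem_nhdsWithin] with z hzU hzD
      exact (hneg z hzD hzU).le
    · by_contra! h
      have : p ∈ D ∩ U := by rw [hDU]; exact ⟨hpU, h⟩
      exact hpD this.1
  set R : ℝ := Metric.diam D + 1 with hRdef
  have hRpos : 0 < R := by positivity
  have hR : ∀ z ∈ D, ∀ w ∈ D, ‖w - z‖ < R := fun z hz w hw => by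
    rw [← dist_eq_norm]
    exact (Metric.dist_le_diam_of_mem hD_bdd hw hz).trans_lt (lt_add_one _)
  rw [ENNReal.tendsto_nhds_zero]
  intro ε hε
  obtain ⟨η, hηε, hη⟩ := (((ENNReal.tendsto_nhds_zero.1
    (tendsto_volume_slab L hL (3 * R) (12 * R))) ε hε).and self_mem_nhdsWithin).exists
  have hη : 0 < η := hη
  -- Strictness allows both `w` and `z` to vary while the linear part stays `dρ_p`, so one `L`
  -- serves all `z`.
  obtain ⟨s, hs, happrox⟩ := hstrict.approximates_deriv_on_nhds (c := ⟨η, hη.le⟩) (Or.inr hη)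
  obtain ⟨r, hr, hball⟩ := Metric.mem_nhds_iff.1 (inter_mem hs (hU.mem_nhds hpU))
  have hsmall : ∀ᶠ z in 𝓝[D] p, -ρ z < η * min (r / 2) R := by
    refine hρtend.neg.eventually (gt_mem_nhds ?_)
    rw [hρ0, neg_zero]
    positivity
  have hzball : ∀ᶠ z in 𝓝[D] p, z ∈ Metric.ball p (r / 2) :=
    mem_nhdsWithin_of_mem_nhds (Metric.ball_mem_nhds p (half_pos hr))
  filter_upwards [self_mem_nhdsWithin, hsmall, hzball, hUD] with z hzD hzs hzb hzU
  have hd : 0 < -ρ z := neg_pos.2 (hneg z hzD hzU)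
  have hτ : -ρ z / η < min (r / 2) R := by rwa [div_lt_iff₀' hη]
  refine (measure_mono (sibonyIndicatrix_subset_slab hzD L hd hη
    (hτ.le.trans (min_le_right _ _)) (hR z hzD) ?_)).trans hηε
  intro w hwD hwτ
  have hwb : w ∈ Metric.ball p r := by
    have h1 : dist w z < r / 2 := by
      rw [dist_eq_norm]; exact hwτ.trans (hτ.trans_le (min_le_left _ _))
    have h2 : dist z p < r / 2 := hzb
    exact (dist_triangle w z p).trans_lt (by linarith)
  have hzb' : z ∈ Metric.ball p r := Metric.ball_subset_ball (by linarith) hzb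
  have h1 := happrox w (hball hwb).1 z (hball hzb').1
  have h2 := hneg w hwD (hball hwb).2
  have h3 : η * ‖w - z‖ < -ρ z := by rwa [lt_div_iff₀' hη] at hwτ
  rw [hLre]
  rw [Real.norm_eq_abs] at h1
  -- `Re L (w - z) ≤ ρ w - ρ z + η‖w - z‖ < 0 + d + d`, with `d = -ρ z`.
  have h4 : -(η * ‖w - z‖) ≤ ρ w - ρ z - fderiv ℝ ρ p (w - z) := (abs_le.1 h1).1
  linarith
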